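/- For an odd prime power $q$ let $G=SL_2(\mathbb{F}_q)$ and, for $g\in G$, let $$\mathcal{N}(g)=\frac{\#\{(x,y)\in G\times G:\ xyx^{-1}y^{-1}=g\}}{\#G}.$$ Then there is an absolute constant $C$ such that for every odd prime power $q$ and every $g\in SL_2(\mathbb{F}_q)$ with $g\neq\pm I$, $$|\mathcal{N}(g)-1|\le \frac{C}{q},$$ that is, $\mathcal{N}(g)=1+O(1/q)$ uniformly in $g\neq\pm I$. Explicitly, for all such $q$ and $g$, $$|\mathcal{N}(g)-1|\le \frac{6}{q+1}+\frac{13}{q^2-1}.$$ -/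

import Mathlib

open scoped MatrixGroups

/-- The fiber over `g` of the commutator map `(x, y) ↦ x * y * x⁻¹ * y⁻¹` of a group `G`. -/
def commutatorFiber {G : Type*} [Group G] (g : G) : Set (G × G) :=
  {p : G × G | p.1 * p.2 * p.1⁻¹ * p.2⁻¹ = g}

/-- The normalized cardinality `#{(x, y) ∈ G × G : [x, y] = g} / #G` of the fiber over `g`
of the commutator map, for a finite group `G`. -/
noncomputable def normalizedFiberCard {G : Type*} [Group G] [Finite G] (g : G) : ℝ :=
  (Nat.card (commutatorFiber g) : ℝ) / (Nat.card G : ℝ)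

/-! ### Character sums and binary quadratic forms over a finite field. -/

section FiniteField

open Finset

variable {F : Type*} [Field F] [Fintype F] [DecidableEq F]

/-! With `z = x⁻¹`, the equation `[x, y] = g` says that `y` conjugates `z` to `z * g`, so the fiber
is a sum over `z` of intertwiner counts (`card_commutatorFiber`). Only those `z` with `tr (z * g) =
tr z` contribute, and there are `q ^ 2 + O(q)` of them.

When that trace `t` is not `±2`, the intertwiners are the points of a conic `a ^ 2 + t * a * b + b ^
2 = δ`, hence `q ± 1` in number (`exists_card_intertwiner_eq`,
`abs_card_filter_binary_quadratic_sub_le`). The case `t = ±2` allows up to `2 * q` of them, but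
occurs for at most `4 * q` matrices `z`. The fiber thus has `q ^ 3 + O(q ^ 2)` points, against a
group order of `q ^ 3 - q`. Everything is counted for `g` a companion matrix, to which any
noncentral `g` reduces. -/

theorem card_filter_monic_quadratic_le (m n : F) :
    #{c : F | c ^ 2 + m * c + n = 0} ≤ 2 := by
  by_cases h : ∃ r : F, r ^ 2 + m * r + n = 0
  · obtain ⟨r, hr⟩ := h
    refine (card_le_card (t := {r, -m - r}) fun c hc ↦ ?_).trans card_le_two
    simp only [mem_filter, mem_univ, true_and] at hc
    have h0 : (c - r) * (c - (-m - r)) = 0 := by linear_combination hc - hr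
    rcases mul_eq_zero.1 h0 with h1 | h1
    · simp [sub_eq_zero.1 h1]
    · simp [sub_eq_zero.1 h1]
  · push Not at h
    simp [h]

theorem quadraticChar_sum_affine (hF : ringChar F ≠ 2) (b : F) {a : F} (ha : a ≠ 0) :
    ∑ v : F, quadraticChar F (b + a * v) = 0 := by
  rw [← quadraticChar_sum_zero hF]
  exact Fintype.sum_equiv ((Equiv.mulLeft₀ a ha).trans (Equiv.addLeft b)) _ _ fun v ↦ by simp

/-- For `u ≠ 0`, pulling out the square `u ^ 2` leaves `χ(d + δ / u)`. Inverting `u` gives a full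
affine sum, which vanishes, minus its term `χ(d)` at `0`. -/
theorem quadraticChar_sum_mul_affine (hF : ringChar F ≠ 2) (d : F) {δ : F} (hδ : δ ≠ 0) :
    ∑ u : F, quadraticChar F u * quadraticChar F (δ + d * u) = -quadraticChar F d := by
  have h1 : ∑ u : F, quadraticChar F u * quadraticChar F (δ + d * u) =
      ∑ u : F, if u = 0 then 0 else quadraticChar F (d + δ * u⁻¹) := by
    refine sum_congr rfl fun u _ ↦ ?_
    split_ifs with h
    · simp [h]
    · rw [← map_mul, show u * (δ + d * u) = u ^ 2 * (d + δ * u⁻¹) by field_simp; ring, map_mul,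
        quadraticChar_sq_one' h, one_mul]
  have h2 : ∑ u : F, (if u = 0 then 0 else quadraticChar F (d + δ * u⁻¹)) =
      ∑ v : F, if v = 0 then 0 else quadraticChar F (d + δ * v) :=
    Fintype.sum_equiv (Equiv.inv F) _ _ fun u ↦ by simp
  have h3 : ∑ v : F, quadraticChar F (d + δ * v) =
      ∑ v : F, (if v = 0 then 0 else quadraticChar F (d + δ * v)) + quadraticChar F d := by
    have : quadraticChar F d = ∑ v : F, if v = 0 then quadraticChar F d else 0 := by simp
    rw [this, ← sum_add_distrib]
    refine sum_congr rfl fun v _ ↦ ?_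
    split_ifs with h <;> simp [h]
  rw [h1, h2]
  rw [quadraticChar_sum_affine hF d hδ] at h3
  linarith

theorem card_filter_sq_eq (hF : ringChar F ≠ 2) (a : F) :
    (#{x : F | x ^ 2 = a} : ℤ) = quadraticChar F a + 1 := by
  rw [← quadraticChar_card_sqrts hF a]
  congr 2
  ext; simp

theorem sum_comp_sq (hF : ringChar F ≠ 2) (f : F → ℤ) :
    ∑ y : F, f (y ^ 2) = ∑ u : F, (quadraticChar F u + 1) * f u := by
  rw [← sum_fiberwise' univ (fun y : F ↦ y ^ 2) f]
  refine sum_congr rfl fun u _ ↦ ?_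
  rw [sum_const, nsmul_eq_mul, card_filter_sq_eq hF]

theorem card_filter_sq_eq_add_mul_sq (hF : ringChar F ≠ 2) {d δ : F} (hd : d ≠ 0) (hδ : δ ≠ 0) :
    (#{p : F × F | p.1 ^ 2 = δ + d * p.2 ^ 2} : ℤ) = Fintype.card F - quadraticChar F d := by
  have h : (#{p : F × F | p.1 ^ 2 = δ + d * p.2 ^ 2} : ℤ) =
      ∑ y : F, (#{x : F | x ^ 2 = δ + d * y ^ 2} : ℤ) := by
    simp only [card_filter, Nat.cast_sum]
    exact Fintype.sum_prod_type_right _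
  simp_rw [h, card_filter_sq_eq hF]
  rw [sum_add_distrib, sum_comp_sq hF fun u ↦ quadraticChar F (δ + d * u)]
  simp_rw [add_mul, one_mul]
  rw [sum_add_distrib, quadraticChar_sum_affine hF δ hd, quadraticChar_sum_mul_affine hF d hδ]
  simp
  ring

/-- Completing the square diagonalizes the form; `t ^ 2 ≠ 4` is exactly its nondegeneracy. -/
theorem abs_card_filter_binary_quadratic_sub_le (hF : ringChar F ≠ 2) {t δ : F} (ht : t ^ 2 ≠ 4)
    (hδ : δ ≠ 0) :
    |(#{p : F × F | p.1 ^ 2 + t * p.1 * p.2 + p.2 ^ 2 = δ} : ℤ) - Fintype.card F| ≤ 1 := by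
  have h2 : (2 : F) ≠ 0 := Ring.two_ne_zero hF
  have hd : t ^ 2 / 4 - 1 ≠ 0 := by
    intro h
    apply ht
    have h4 : (4 : F) ≠ 0 := by simpa [show (4 : F) = 2 * 2 by norm_num] using h2
    field_simp at h
    linear_combination h
  have h : #{p : F × F | p.1 ^ 2 + t * p.1 * p.2 + p.2 ^ 2 = δ} =
      #{p : F × F | p.1 ^ 2 = δ + (t ^ 2 / 4 - 1) * p.2 ^ 2} := by
    refine card_bij' (fun p _ ↦ (p.1 + t / 2 * p.2, p.2)) (fun p _ ↦ (p.1 - t / 2 * p.2, p.2))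
      ?_ ?_ ?_ ?_
    · intro p hp
      simp only [mem_filter, mem_univ, true_and] at hp ⊢
      rw [← hp, show (4 : F) = 2 * 2 by norm_num]
      field_simp
      ring
    · intro p hp
      simp only [mem_filter, mem_univ, true_and] at hp ⊢
      rw [show (4 : F) = 2 * 2 by norm_num] at hp
      have e : t ^ 2 / (2 * 2) = (t / 2) ^ 2 := by field_simp
      have e' : t = 2 * (t / 2) := by field_simp
      rw [e] at hp
      generalize t / 2 = s at *
      rw [e']
      linear_combination hp
    · simp
    · simp
  rw [h, card_filter_sq_eq_add_mul_sq hF hd hδ]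
  rcases quadraticChar_dichotomy hd with h | h <;> simp [h]

theorem card_filter_binary_quadratic_le (t δ : F) :
    #{p : F × F | p.1 ^ 2 + t * p.1 * p.2 + p.2 ^ 2 = δ} ≤ 2 * Fintype.card F := by
  have h : #{p : F × F | p.1 ^ 2 + t * p.1 * p.2 + p.2 ^ 2 = δ} =
      ∑ y : F, #{x : F | x ^ 2 + (t * y) * x + (y ^ 2 - δ) = 0} := by
    simp only [card_filter]
    rw [Fintype.sum_prod_type_right]
    refine sum_congr rfl fun y _ ↦ sum_congr rfl fun x _ ↦ if_congr ?_ rfl rfl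
    constructor <;> intro h <;> linear_combination h
  rw [h]
  refine (sum_le_card_nsmul _ _ 2 fun y _ ↦ card_filter_monic_quadratic_le _ _).trans ?_
  simp [mul_comm]

end FiniteField

/-! ### Conjugacy, intertwiners and the order of `SL(2, F)`. -/

section SpecialLinear

open Matrix

variable {F : Type*} [Field F]

/-- The companion matrix of `X ^ 2 - t * X + 1`, as an element of `SL(2, F)`. -/
def companionSL (t : F) : SL(2, F) := ⟨!![0, -1; 1, t], by simp [det_fin_two]⟩

theorem coe_companionSL (t : F) : (companionSL t : Matrix (Fin 2) (Fin 2) F) = !![0, -1; 1, t] :=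
  rfl

theorem SL2_ad_sub_bc (z : SL(2, F)) : z 0 0 * z 1 1 - z 0 1 * z 1 0 = 1 := by
  rw [← det_fin_two]; exact z.2

theorem SL2_trace (z : SL(2, F)) : trace (z : Matrix (Fin 2) (Fin 2) F) = z 0 0 + z 1 1 :=
  trace_fin_two _

theorem SL2_trace_conj (y z : SL(2, F)) :
    trace ((y * z * y⁻¹ : SL(2, F)) : Matrix (Fin 2) (Fin 2) F) =
      trace (z : Matrix (Fin 2) (Fin 2) F) := by
  change trace ((y * z : SL(2, F)).1 * (y⁻¹ : SL(2, F)).1) = trace z.1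
  rw [trace_mul_comm]
  change trace (y⁻¹ * (y * z) : SL(2, F)).1 = trace z.1
  rw [inv_mul_cancel_left]

/-- A non-central element of `SL(2, F)` has a cyclic vector. -/
theorem SL2_exists_conj_companionSL {z : SL(2, F)} (h1 : z ≠ 1) (h2 : z ≠ -1) :
    ∃ P : GL (Fin 2) F, (z : Matrix (Fin 2) (Fin 2) F) * P =
      P * (companionSL (trace (z : Matrix (Fin 2) (Fin 2) F)) : Matrix (Fin 2) (Fin 2) F) := by
  have hdet := SL2_ad_sub_bc z
  -- The expression is the determinant of the columns `v, z v` for `v = (x, y)`. If it always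
  -- vanished, every vector would be an eigenvector and `z` a scalar of determinant 1.
  obtain ⟨x, y, hxy⟩ : ∃ x y : F,
      x * (z 1 0 * x + z 1 1 * y) - y * (z 0 0 * x + z 0 1 * y) ≠ 0 := by
    by_contra! h
    have hc : z 1 0 = 0 := by simpa using h 1 0
    have hb : z 0 1 = 0 := by simpa using h 0 1
    have hd : z 1 1 = z 0 0 := by
      have := h 1 1
      rw [hb, hc] at this
      linear_combination this
    rw [hb, hd] at hdet
    have hs : (z 0 0 - 1) * (z 0 0 + 1) = 0 := by linear_combination hdet
    rcases mul_eq_zero.1 hs with h | h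
    · apply h1
      ext i j
      fin_cases i <;> fin_cases j <;> simp [hb, hc, hd, sub_eq_zero.1 h]
    · apply h2
      ext i j
      fin_cases i <;> fin_cases j <;> simp [hb, hc, hd, eq_neg_of_add_eq_zero_left h]
  refine ⟨GeneralLinearGroup.mkOfDetNeZero
    !![x, z 0 0 * x + z 0 1 * y; y, z 1 0 * x + z 1 1 * y] ?_, ?_⟩
  · rw [det_fin_two_of]
    intro h
    exact hxy (by linear_combination h)
  · ext i j
    fin_cases i <;> fin_cases j <;>
      simp [GeneralLinearGroup.mkOfDetNeZero, companionSL, mul_apply, Fin.sum_univ_two,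
        trace_fin_two]
    · linear_combination -x * hdet
    · linear_combination -y * hdet

/-- Conjugation by an invertible matrix, as an automorphism of `SL(2, F)`. -/
def SLConj (P : GL (Fin 2) F) : SL(2, F) ≃* SL(2, F) where
  toFun z := ⟨P * z * (P⁻¹ : GL (Fin 2) F), by
    simp [mul_inv_cancel₀ (GeneralLinearGroup.det_ne_zero P)]⟩
  invFun z := ⟨(P⁻¹ : GL (Fin 2) F) * z * P, by
    simp [inv_mul_cancel₀ (GeneralLinearGroup.det_ne_zero P)]⟩
  left_inv z := by
    ext1
    simp [mul_assoc]
  right_inv z := by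
    ext1
    simp [mul_assoc]
  map_mul' z w := by
    apply Subtype.ext
    change (P : Matrix (Fin 2) (Fin 2) F) * (z * w) * (P⁻¹ : GL (Fin 2) F) =
      P * z * (P⁻¹ : GL (Fin 2) F) * (P * w * (P⁻¹ : GL (Fin 2) F))
    simp [mul_assoc]

theorem coe_SLConj (P : GL (Fin 2) F) (z : SL(2, F)) :
    (SLConj P z : Matrix (Fin 2) (Fin 2) F) = P * z * (P⁻¹ : GL (Fin 2) F) := rfl

/-- The conjugating matrix may lie outside `SL(2, F)`, but conjugation by it is still an
automorphism, and fiber sizes are invariant under automorphisms. -/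
theorem SL2_exists_mulEquiv_companionSL {g : SL(2, F)} (h1 : g ≠ 1) (h2 : g ≠ -1) :
    ∃ (e : SL(2, F) ≃* SL(2, F)) (τ : F), e (companionSL τ) = g := by
  obtain ⟨P, hP⟩ := SL2_exists_conj_companionSL h1 h2
  refine ⟨SLConj P, trace (g : Matrix (Fin 2) (Fin 2) F), Subtype.ext ?_⟩
  rw [coe_SLConj, ← hP, mul_assoc]
  simp

theorem normalizedFiberCard_mulEquiv {G H : Type*} [Group G] [Group H] [Finite G] [Finite H]
    (e : G ≃* H) (g : G) : normalizedFiberCard (e g) = normalizedFiberCard g := by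
  have h : Nat.card (commutatorFiber g) = Nat.card (commutatorFiber (e g)) := by
    refine Nat.card_congr ((e.toEquiv.prodCongr e.toEquiv).subtypeEquiv fun p ↦ ?_)
    simp only [commutatorFiber, Set.mem_ofPred_eq, Equiv.prodCongr_apply, Prod.map_fst,
      Prod.map_snd, MulEquiv.toEquiv_eq_coe, MulEquiv.coe_toEquiv, ← map_inv, ← map_mul]
    exact e.injective.eq_iff.symm
  rw [normalizedFiberCard, normalizedFiberCard, h, Nat.card_congr e.toEquiv]

/-- The fiber of the commutator map over `g` consists of the `(x, y)` for which `y` conjugates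
`x⁻¹` to `x⁻¹ * g`. -/
theorem card_commutatorFiber {G : Type*} [Group G] [Fintype G] (g : G) :
    Nat.card (commutatorFiber g) = ∑ z : G, Nat.card {y : G // y * z = z * g * y} := by
  rw [← Nat.card_sigma]
  refine Nat.card_congr (.trans (.subtypeEquiv ((Equiv.inv G).prodCongr (.refl G)) fun p ↦ ?_)
    (Equiv.subtypeProdEquivSigmaSubtype fun z y : G ↦ y * z = z * g * y))
  simp only [commutatorFiber, Set.mem_ofPred_eq, Equiv.prodCongr_apply, Prod.map_fst,
    Prod.map_snd, Equiv.inv_apply, Equiv.refl_apply]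
  rw [mul_assoc p.1⁻¹, eq_inv_mul_iff_mul_eq, mul_inv_eq_iff_eq_mul, mul_assoc p.1]

/-- The matrices that intertwine two non-central elements of `SL(2, F)` of the same trace form a
plane, on which the determinant is a multiple of the form `a ^ 2 + t * a * b + b ^ 2`. -/
theorem exists_card_intertwiner_eq {z w : SL(2, F)} (hz1 : z ≠ 1) (hz2 : z ≠ -1)
    (hw1 : w ≠ 1) (hw2 : w ≠ -1) {t : F} (hz : trace (z : Matrix (Fin 2) (Fin 2) F) = t)
    (hw : trace (w : Matrix (Fin 2) (Fin 2) F) = t) :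
    ∃ δ : F, δ ≠ 0 ∧ Nat.card {y : SL(2, F) // y * z = w * y} =
      Nat.card {p : F × F // p.1 ^ 2 + t * p.1 * p.2 + p.2 ^ 2 = δ} := by
  obtain ⟨P, hP⟩ := SL2_exists_conj_companionSL hz1 hz2
  obtain ⟨Q, hQ⟩ := SL2_exists_conj_companionSL hw1 hw2
  rw [hz] at hP
  rw [hw] at hQ
  have hP0 : det (P : Matrix (Fin 2) (Fin 2) F) ≠ 0 := GeneralLinearGroup.det_ne_zero P
  have hQ0 : det (Q : Matrix (Fin 2) (Fin 2) F) ≠ 0 := GeneralLinearGroup.det_ne_zero Q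
  refine ⟨det (P : Matrix (Fin 2) (Fin 2) F) / det (Q : Matrix (Fin 2) (Fin 2) F),
    div_ne_zero hP0 hQ0, ?_⟩
  set K : Matrix (Fin 2) (Fin 2) F := (companionSL t).1 with hK
  have hz' : (z : Matrix (Fin 2) (Fin 2) F) = P * K * (P⁻¹ : GL (Fin 2) F) := by
    rw [← hP, mul_assoc]; simp
  have hw' : (w : Matrix (Fin 2) (Fin 2) F) = Q * K * (Q⁻¹ : GL (Fin 2) F) := by
    rw [← hQ, mul_assoc]; simp
  -- The change of variable `m = Q⁻¹ * y * P` turns intertwiners into the commutant of `K`, and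
  -- scales the determinant by `det P / det Q`.
  let e : Matrix (Fin 2) (Fin 2) F ≃ Matrix (Fin 2) (Fin 2) F :=
    { toFun := fun y ↦ (Q⁻¹ : GL (Fin 2) F) * y * P
      invFun := fun m ↦ Q * m * (P⁻¹ : GL (Fin 2) F)
      left_inv := fun y ↦ by simp [mul_assoc]
      right_inv := fun m ↦ by simp [mul_assoc] }
  -- The commutant is `{a + b * K}`, with `a, b` read off the first column; the determinant there is
  -- `a ^ 2 + t * a * b + b ^ 2`.
  have hcomm (m : Matrix (Fin 2) (Fin 2) F) : m * K = K * m ↔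
      m 0 1 = -m 1 0 ∧ m 1 1 = m 0 0 + t * m 1 0 := by
    rw [hK, coe_companionSL]
    constructor
    · intro h
      have h00 := congr_fun (congr_fun h 0) 0
      have h10 := congr_fun (congr_fun h 1) 0
      simp [mul_apply, Fin.sum_univ_two] at h00 h10
      exact ⟨h00, h10⟩
    · rintro ⟨h1, h2⟩
      ext i j
      fin_cases i <;> fin_cases j <;> simp [mul_apply, Fin.sum_univ_two, h1, h2] <;> ring
  have hint (m : Matrix (Fin 2) (Fin 2) F) : e.symm m * z = w * e.symm m ↔ m * K = K * m := by
    have h1 : e.symm m * z = e.symm (m * K) := by simp [e, hz', mul_assoc]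
    have h2 : w * e.symm m = e.symm (K * m) := by simp [e, hw', mul_assoc]
    rw [h1, h2, e.symm.injective.eq_iff]
  have hdet (m : Matrix (Fin 2) (Fin 2) F) : det (e.symm m) = 1 ↔
      det m = det (P : Matrix (Fin 2) (Fin 2) F) / det (Q : Matrix (Fin 2) (Fin 2) F) := by
    have : det (e.symm m) = det (Q : Matrix (Fin 2) (Fin 2) F) * det m /
        det (P : Matrix (Fin 2) (Fin 2) F) := by
      simp [e, div_eq_mul_inv]
    rw [this, div_eq_iff hP0, eq_div_iff hQ0, one_mul, mul_comm]
  refine Nat.card_congr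
    { toFun := fun y ↦ ⟨(e y.1 0 0, e y.1 1 0), ?_⟩
      invFun := fun p ↦ ⟨⟨e.symm !![p.1.1, -p.1.2; p.1.2, p.1.1 + t * p.1.2], ?_⟩, ?_⟩
      left_inv := fun y ↦ ?_
      right_inv := fun p ↦ by simp }
  · have h1 := (hdet (e y.1)).1 (by simp)
    have h2 := (hcomm (e y.1)).1 ((hint _).1 (by simpa using congr_arg Subtype.val y.2))
    rw [det_fin_two, h2.1, h2.2] at h1
    rw [← h1]
    ring
  · rw [hdet, det_fin_two_of]
    refine Eq.trans ?_ p.2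
    ring
  · refine Subtype.ext ?_
    change e.symm _ * (z : Matrix (Fin 2) (Fin 2) F) = w * e.symm _
    rw [hint, hcomm]
    simp
  · have h2 := (hcomm (e y.1)).1 ((hint _).1 (by simpa using congr_arg Subtype.val y.2))
    refine Subtype.ext (Subtype.ext ?_)
    simp only
    rw [Equiv.symm_apply_eq, ← h2.1, ← h2.2]
    exact (eta_fin_two _).symm

/-- `SL(2, F)` is the kernel of the surjective determinant on `GL (Fin 2) F`. -/
theorem card_SL2 [Fintype F] :
    Nat.card SL(2, F) = Fintype.card F ^ 3 - Fintype.card F := by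
  classical
  have hq : 1 < Fintype.card F := Fintype.one_lt_card
  have h1 := (GeneralLinearGroup.det (n := Fin 2) (R := F)).ker.card_mul_index
  have hr : (GeneralLinearGroup.det (n := Fin 2) (R := F)).range = ⊤ := by
    rw [MonoidHom.range_eq_top]
    intro u
    refine ⟨GeneralLinearGroup.mkOfDetNeZero !![(u : F), 0; 0, 1] (by simp), ?_⟩
    ext
    simp [GeneralLinearGroup.mkOfDetNeZero]
  have hk : Nat.card (GeneralLinearGroup.det (n := Fin 2) (R := F)).ker = Nat.card SL(2, F) := by
    refine Nat.card_congr
      { toFun := fun A ↦ ⟨A.1, ?_⟩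
        invFun := fun A ↦ ⟨SpecialLinearGroup.toGL A, ?_⟩
        left_inv := fun A ↦ ?_
        right_inv := fun A ↦ ?_ }
    · simpa using congr_arg Units.val (MonoidHom.mem_ker.1 A.2)
    · rw [MonoidHom.mem_ker]
      ext
      simp
    · exact Subtype.ext (Units.ext rfl)
    · rfl
  rw [Subgroup.index_ker, hk, hr, Subgroup.card_top, card_GL_field, Nat.card_units,
    Fin.prod_univ_two, Nat.card_eq_fintype_card (α := F)] at h1
  obtain ⟨k, hk⟩ : ∃ k, Fintype.card F = k + 2 := ⟨Fintype.card F - 2, by omega⟩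
  rw [hk] at h1 ⊢
  have e1 : k + 2 - 1 = k + 1 := rfl
  have e2 : (k + 2) ^ 2 - (k + 2) ^ ((0 : Fin 2) : ℕ) = (k + 1) * (k + 3) := by
    simp only [Fin.val_zero, pow_zero]
    rw [Nat.sub_eq_iff_eq_add (by nlinarith)]
    ring
  have e3 : (k + 2) ^ 2 - (k + 2) ^ ((1 : Fin 2) : ℕ) = (k + 1) * (k + 2) := by
    simp only [Fin.val_one, pow_one]
    rw [Nat.sub_eq_iff_eq_add (by nlinarith)]
    ring
  have e4 : (k + 2) ^ 3 - (k + 2) = (k + 3) * ((k + 1) * (k + 2)) := by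
    rw [Nat.sub_eq_iff_eq_add (by nlinarith)]
    ring
  rw [e1, e2, e3] at h1
  rw [e4]
  have : 0 < k + 1 := by omega
  apply Nat.eq_of_mul_eq_mul_right this
  rw [h1]
  ring

end SpecialLinear

/-! ### Counting the fiber over a companion matrix. -/

section Counting

open Finset Matrix

variable {F : Type*} [Field F] [Fintype F] [DecidableEq F]

theorem abs_card_intertwiner_sub_le (hF : ringChar F ≠ 2) {g z : SL(2, F)} (hg : g ≠ 1)
    (h : trace ((z * g : SL(2, F)) : Matrix (Fin 2) (Fin 2) F) =
      trace (z : Matrix (Fin 2) (Fin 2) F)) :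
    |(Nat.card {y : SL(2, F) // y * z = z * g * y} : ℤ) - Fintype.card F| ≤
      1 + if trace (z : Matrix (Fin 2) (Fin 2) F) ^ 2 = 4 then (Fintype.card F : ℤ) else 0 := by
  by_cases hc : (z = 1 ∨ z = -1) ∨ (z * g = 1 ∨ z * g = -1)
  · have ht : trace (z : Matrix (Fin 2) (Fin 2) F) ^ 2 = 4 := by
      rcases hc with (hc | hc) | (hc | hc)
      · rw [hc]; norm_num [SL2_trace]
      · rw [hc]; norm_num [SL2_trace]
      · rw [← h, hc]; norm_num [SL2_trace]
      · rw [← h, hc]; norm_num [SL2_trace]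
    -- A central element is conjugate only to itself, so an intertwiner would force `z = z * g`.
    have hempty : IsEmpty {y : SL(2, F) // y * z = z * g * y} := by
      refine ⟨fun ⟨y, hy⟩ ↦ hg ?_⟩
      have hzg : z = z * g := by
        rcases hc with (hc | hc) | (hc | hc)
        · rw [hc] at hy
          exact (hg (by simpa using hy)).elim
        · rw [hc] at hy
          exact (hg (by simpa using hy)).elim
        · rw [hc] at hy ⊢
          simpa using hy
        · rw [hc, neg_one_mul, ← mul_neg_one] at hy
          rw [hc]
          exact mul_left_cancel hy
      exact mul_eq_left.1 hzg.symm
    rw [Nat.card_of_isEmpty, if_pos ht]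
    simp
  · push Not at hc
    obtain ⟨δ, hδ, hw⟩ := exists_card_intertwiner_eq hc.1.1 hc.1.2 hc.2.1 hc.2.2 rfl h
    rw [hw, Nat.card_eq_fintype_card, Fintype.card_subtype]
    split_ifs with ht
    · have h2 := card_filter_binary_quadratic_le (trace (z : Matrix (Fin 2) (Fin 2) F)) δ
      rw [abs_le]
      constructor <;> omega
    · simpa using abs_card_filter_binary_quadratic_sub_le hF ht hδ

/-- In the coordinates `(t, c, d)`, the trace and the bottom row, the trace condition determines the
top row, and `det z = 1` becomes linear in `t`. -/
theorem card_filter_trace_mul_companionSL (τ : F) (R : F → Prop) [DecidablePred R] :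
    #{z : SL(2, F) | trace ((z * companionSL τ : SL(2, F)) : Matrix (Fin 2) (Fin 2) F) =
        trace (z : Matrix (Fin 2) (Fin 2) F) ∧ R (trace (z : Matrix (Fin 2) (Fin 2) F))} =
      #{p : F × F × F | p.1 * (p.2.2 - p.2.1) =
        p.2.1 ^ 2 - τ * p.2.1 * p.2.2 + p.2.2 ^ 2 + 1 ∧ R p.1} := by
  have htr (z : SL(2, F)) :
      trace ((z * companionSL τ : SL(2, F)) : Matrix (Fin 2) (Fin 2) F) =
        z 0 1 - z 1 0 + τ * z 1 1 := by
    rw [SL2_trace]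
    simp [coe_companionSL, mul_apply, Fin.sum_univ_two]
    ring
  refine card_bij' (fun z _ ↦ (trace (z : Matrix (Fin 2) (Fin 2) F), z 1 0, z 1 1))
    (fun p hp ↦ ⟨!![p.1 - p.2.2, p.1 + p.2.1 - τ * p.2.2; p.2.1, p.2.2], ?_⟩) ?_ ?_ ?_ ?_
  · simp only [mem_filter, mem_univ, true_and] at hp
    rw [det_fin_two_of]
    linear_combination hp.1
  · intro z hz
    simp only [mem_filter, mem_univ, true_and] at hz ⊢
    refine ⟨?_, hz.2⟩
    have h1 := hz.1
    rw [htr, SL2_trace] at h1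
    rw [SL2_trace]
    linear_combination SL2_ad_sub_bc z + z 1 0 * h1
  · intro p hp
    simp only [mem_filter, mem_univ, true_and] at hp
    refine mem_filter.2 ⟨mem_univ _, (htr _).trans (Eq.trans ?_ (SL2_trace _).symm), ?_⟩
    · change p.1 + p.2.1 - τ * p.2.2 - p.2.1 + τ * p.2.2 = p.1 - p.2.2 + p.2.2
      ring
    · convert hp.2
      exact (SL2_trace _).trans (sub_add_cancel _ _)
  · intro z hz
    simp only [mem_filter, mem_univ, true_and] at hz
    have h1 := hz.1
    rw [htr, SL2_trace] at h1
    ext i j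
    fin_cases i <;> fin_cases j <;> simp [SL2_trace]
    linear_combination -h1
  · intro p hp
    simp

theorem abs_card_filter_trace_mul_companionSL_sub_le (τ : F) :
    |(#{z : SL(2, F) | trace ((z * companionSL τ : SL(2, F)) : Matrix (Fin 2) (Fin 2) F) =
        trace (z : Matrix (Fin 2) (Fin 2) F)} : ℤ) - (Fintype.card F : ℤ) ^ 2| ≤
      Fintype.card F := by
  -- Off the diagonal there is one `t`; on it, every `t` or none.
  have hpair (c d : F) : (#{t : F | t * (d - c) = c ^ 2 - τ * c * d + d ^ 2 + 1} : ℤ) =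
      1 + if d = c then
        (if (2 - τ) * c ^ 2 + 1 = 0 then (Fintype.card F : ℤ) else 0) - 1 else 0 := by
    split_ifs with h1 h2
    · subst h1
      rw [filter_true_of_mem fun t _ ↦ by linear_combination -h2]
      simp
    · subst h1
      rw [filter_false_of_mem fun t _ h ↦ h2 (by linear_combination -h)]
      simp
    · have : ({t : F | t * (d - c) = c ^ 2 - τ * c * d + d ^ 2 + 1} : Finset F) =
          {(c ^ 2 - τ * c * d + d ^ 2 + 1) / (d - c)} := by
        ext t
        simp [eq_div_iff (sub_ne_zero.2 h1)]
      simp [this]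
  have hk : #{c : F | (2 - τ) * c ^ 2 + 1 = 0} ≤ 2 := by
    by_cases hτ : 2 - τ = 0
    · simp [hτ]
    · refine (card_le_card fun c hc ↦ ?_).trans (card_filter_monic_quadratic_le 0 (1 / (2 - τ)))
      simp only [mem_filter, mem_univ, true_and] at hc ⊢
      field_simp
      linear_combination hc
  have h := card_filter_trace_mul_companionSL τ fun _ ↦ True
  simp only [and_true] at h
  have hsum : (#{p : F × F × F | p.1 * (p.2.2 - p.2.1) =
        p.2.1 ^ 2 - τ * p.2.1 * p.2.2 + p.2.2 ^ 2 + 1} : ℤ) =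
      ∑ c : F, ∑ d : F, (#{t : F | t * (d - c) = c ^ 2 - τ * c * d + d ^ 2 + 1} : ℤ) := by
    simp only [card_filter, Nat.cast_sum]
    rw [Fintype.sum_prod_type_right, Fintype.sum_prod_type]
  have hval : ∑ c : F, ∑ d : F,
      (#{t : F | t * (d - c) = c ^ 2 - τ * c * d + d ^ 2 + 1} : ℤ) =
      (Fintype.card F : ℤ) ^ 2 - Fintype.card F +
        Fintype.card F * #{c : F | (2 - τ) * c ^ 2 + 1 = 0} := by
    simp_rw [hpair, sum_add_distrib, sum_ite_eq', mem_univ, if_true, sum_sub_distrib, sum_ite,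
      sum_const]
    simp
    ring
  rw [h, hsum, hval]
  have h0 : (0 : ℤ) ≤ Fintype.card F := by positivity
  have hk' : (#{c : F | (2 - τ) * c ^ 2 + 1 = 0} : ℤ) ≤ 2 := by exact_mod_cast hk
  have hk0 : (0 : ℤ) ≤ #{c : F | (2 - τ) * c ^ 2 + 1 = 0} := by positivity
  rw [abs_le]
  constructor <;> nlinarith

/-- Two choices of `t`, `q` of `d`, then a monic quadratic in `c`. -/
theorem card_filter_trace_sq_eq_four_le (τ : F) :
    #{z : SL(2, F) | trace ((z * companionSL τ : SL(2, F)) : Matrix (Fin 2) (Fin 2) F) =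
        trace (z : Matrix (Fin 2) (Fin 2) F) ∧ trace (z : Matrix (Fin 2) (Fin 2) F) ^ 2 = 4} ≤
      4 * Fintype.card F := by
  rw [card_filter_trace_mul_companionSL τ fun t ↦ t ^ 2 = 4]
  have hsum : #{p : F × F × F | p.1 * (p.2.2 - p.2.1) =
        p.2.1 ^ 2 - τ * p.2.1 * p.2.2 + p.2.2 ^ 2 + 1 ∧ p.1 ^ 2 = 4} =
      ∑ t : F with t ^ 2 + 0 * t + -4 = 0, ∑ d : F,
        #{c : F | c ^ 2 + (t - τ * d) * c + (d ^ 2 - t * d + 1) = 0} := by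
    simp only [card_filter]
    rw [Fintype.sum_prod_type, sum_filter]
    refine sum_congr rfl fun t _ ↦ ?_
    rw [Fintype.sum_prod_type_right]
    split_ifs with ht
    · refine sum_congr rfl fun d _ ↦ sum_congr rfl fun c _ ↦ if_congr ?_ rfl rfl
      constructor
      · rintro ⟨h, -⟩
        linear_combination -h
      · intro h
        exact ⟨by linear_combination -h, by linear_combination ht⟩
    · refine sum_eq_zero fun d _ ↦ sum_eq_zero fun c _ ↦ if_neg fun h ↦ ht ?_
      linear_combination h.2
  have hinner (t : F) : ∑ d : F,
      #{c : F | c ^ 2 + (t - τ * d) * c + (d ^ 2 - t * d + 1) = 0} ≤ Fintype.card F * 2 := by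
    refine (sum_le_card_nsmul _ _ 2 fun d _ ↦ card_filter_monic_quadratic_le _ _).trans ?_
    simp
  rw [hsum]
  refine (sum_le_card_nsmul _ _ _ fun t _ ↦ hinner t).trans ?_
  have h2 := card_filter_monic_quadratic_le (0 : F) (-4)
  rw [smul_eq_mul]
  nlinarith

theorem abs_card_commutatorFiber_companionSL_sub_le (hF : ringChar F ≠ 2) (τ : F) :
    |(Nat.card (commutatorFiber (companionSL τ)) : ℤ) - (Fintype.card F : ℤ) ^ 3| ≤
      6 * (Fintype.card F : ℤ) ^ 2 + Fintype.card F := by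
  have hg : companionSL τ ≠ 1 := fun h ↦ by
    have := congr_arg (fun z : SL(2, F) ↦ z 1 0) h
    simp [coe_companionSL] at this
  set q : ℤ := (Fintype.card F : ℤ) with hq
  have hq0 : 0 ≤ q := by positivity
  set T : Finset SL(2, F) :=
    {z : SL(2, F) | trace ((z * companionSL τ : SL(2, F)) : Matrix (Fin 2) (Fin 2) F) =
      trace (z : Matrix (Fin 2) (Fin 2) F)} with hT
  have hT1 : |(#T : ℤ) - q ^ 2| ≤ q := abs_card_filter_trace_mul_companionSL_sub_le τ
  have hT2 : (#(T.filter fun z : SL(2, F) ↦ trace (z : Matrix (Fin 2) (Fin 2) F) ^ 2 = 4) : ℤ) ≤ 4 * q := by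
    rw [hT, filter_filter, hq]
    exact_mod_cast card_filter_trace_sq_eq_four_le τ
  have hcard : (Nat.card (commutatorFiber (companionSL τ)) : ℤ) =
      ∑ z ∈ T, (Nat.card {y : SL(2, F) // y * z = z * companionSL τ * y} : ℤ) := by
    rw [card_commutatorFiber, Nat.cast_sum]
    refine (sum_subset (subset_univ _) fun z _ hz ↦ ?_).symm
    have hempty : IsEmpty {y : SL(2, F) // y * z = z * companionSL τ * y} := by
      refine ⟨fun y ↦ hz ?_⟩
      rw [hT, mem_filter, ← mul_inv_eq_of_eq_mul y.2, SL2_trace_conj]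
      exact ⟨mem_univ _, rfl⟩
    simp
  have hdiff : |∑ z ∈ T, (Nat.card {y : SL(2, F) // y * z = z * companionSL τ * y} : ℤ) -
      #T * q| ≤ #T + 4 * q * q := by
    rw [← nsmul_eq_mul, ← sum_const, ← sum_sub_distrib]
    refine (abs_sum_le_sum_abs _ _).trans ((sum_le_sum fun z hz ↦
      abs_card_intertwiner_sub_le hF hg (mem_filter.1 hz).2).trans ?_)
    rw [sum_add_distrib, ← sum_filter, sum_const, sum_const, nsmul_one, nsmul_eq_mul]
    gcongr
  rw [hcard]
  rw [abs_le] at hT1 hdiff ⊢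
  -- The error is `#T + 4 * q ^ 2 + q * |#T - q ^ 2|`, at most `(q ^ 2 + q) + 4 * q ^ 2 + q ^ 2`.
  constructor <;> nlinarith

end Counting

/-! ### The normalized estimate. -/

theorem abs_normalizedFiberCard_SL2_sub_one_le {F : Type*} [Field F] [Finite F]
    (hF : Odd (Nat.card F)) {g : SL(2, F)} (h1 : g ≠ 1) (h2 : g ≠ -1) :
    |normalizedFiberCard g - 1| ≤
      6 / ((Nat.card F : ℝ) + 1) + 13 / ((Nat.card F : ℝ) ^ 2 - 1) := by
  classical
  have := Fintype.ofFinite F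
  rw [Nat.card_eq_fintype_card] at hF ⊢
  have hchar : ringChar F ≠ 2 := fun h ↦ by
    have := FiniteField.even_card_of_char_two h
    rw [Nat.odd_iff] at hF
    omega
  obtain ⟨e, τ, rfl⟩ := SL2_exists_mulEquiv_companionSL h1 h2
  have hmain := abs_card_commutatorFiber_companionSL_sub_le hchar τ
  have hone : 1 < Fintype.card F := Fintype.one_lt_card
  rw [normalizedFiberCard_mulEquiv, normalizedFiberCard, card_SL2,
    Nat.cast_sub (Nat.le_self_pow (by norm_num) _)]
  generalize Nat.card (commutatorFiber (companionSL τ)) = N at *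
  generalize Fintype.card F = n at *
  have hmain' : |(N : ℝ) - (n : ℝ) ^ 3| ≤ 6 * (n : ℝ) ^ 2 + n := by exact_mod_cast hmain
  have hn : (1 : ℝ) < n := by exact_mod_cast hone
  push_cast
  generalize (n : ℝ) = q at *
  have hq2 : 0 < q ^ 2 - 1 := by nlinarith
  have hq3 : 0 < q ^ 3 - q := by
    rw [show q ^ 3 - q = q * (q ^ 2 - 1) by ring]
    positivity
  -- The numerator needs only `6 * q ^ 2 + 2 * q`: the fiber error plus the `q` in the group order.
  have hrhs : 6 / (q + 1) + 13 / (q ^ 2 - 1) = (6 * q ^ 2 + 7 * q) / (q ^ 3 - q) := by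
    have : q + 1 ≠ 0 := by linarith
    have : q ≠ 0 := by linarith
    rw [show q ^ 3 - q = q * (q ^ 2 - 1) by ring]
    rw [div_add_div _ _ (by assumption) hq2.ne', div_eq_div_iff (by positivity) (by positivity)]
    ring
  rw [hrhs, div_sub_one hq3.ne', abs_div, abs_of_pos hq3]
  gcongr
  rw [abs_le] at hmain' ⊢
  constructor <;> linarith

theorem theorem5p1 :
    (∃ C : ℝ, ∀ (F : Type*) [Field F] [Finite F], Odd (Nat.card F) →
      ∀ g : SL(2, F), g ≠ 1 → g ≠ -1 →
        |normalizedFiberCard g - 1| ≤ C * (1 / (Nat.card F : ℝ))) ∧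
    (∀ (F : Type*) [Field F] [Finite F], Odd (Nat.card F) →
      ∀ g : SL(2, F), g ≠ 1 → g ≠ -1 →
        |normalizedFiberCard g - 1| ≤
          6 / ((Nat.card F : ℝ) + 1) + 13 / ((Nat.card F : ℝ) ^ 2 - 1)) := by
  refine ⟨⟨19, fun F _ _ hF g h1 h2 ↦
    (abs_normalizedFiberCard_SL2_sub_one_le hF h1 h2).trans ?_⟩,
    fun F _ _ hF g h1 h2 ↦ abs_normalizedFiberCard_SL2_sub_one_le hF h1 h2⟩
  have hq : (2 : ℝ) ≤ Nat.card F := by exact_mod_cast Finite.one_lt_card (α := F)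
  generalize (Nat.card F : ℝ) = q at *
  have h6 : 6 / (q + 1) ≤ 6 / q := by gcongr; linarith
  -- `q ≤ q ^ 2 - 1` already holds from `q = 2` on.
  have h13 : 13 / (q ^ 2 - 1) ≤ 13 / q := by gcongr; nlinarith
  calc _ ≤ 6 / q + 13 / q := add_le_add h6 h13
    _ = 19 * (1 / q) := by ring
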